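/- **Lemma (Iteration complexity of DREEM).** Setting. Let $\mathcal S$ be a (measurable) state space, $\mathcal A$ a finite non-empty action set with uniform distribution $U$, $H$ the horizon, $M^\star$ the true transition model, and fix an initial state distribution. For a model $M$ (transition probabilities $P_M(\cdot\mid s,a)$) and a policy $\pi$, let $P_M^{\pi,h}$ be the law of the state at time step $h$ when starting from the initial distribution, choosing actions by $\pi$ and moving by $M$. With $\|\mu-\nu\|_{TV}$ denoting the total variation ($\ell^1$) norm $\sum_s|\mu(s)-\nu(s)|$ (for general measures, the total mass of $|\mu-\nu|$), put for $1\le h\le H$ $$\mathcal W(\pi,M,h)=\mathbb E_{s\sim P_{M^\star}^{\pi,h-1},\,a\sim U}\big\|P_M(\cdot\mid s,a)-P_{M^\star}(\cdot\mid s,a)\big\|_{TV},$$ let $\mathcal D(\pi,M,M',h)$ be the $\ell^1$ distance between the laws of $(s,a,s')$ with $s\sim P_M^{\pi,h-1}$, $a\sim U$, $s'\sim P_M(\cdot\mid s,a)$ and the same with $M'$ in place of $M$, and for a set $\mathcal N$ of models let $v_{\rm explore}(\pi,\mathcal N)=\sup_{M,M'\in\mathcal N}\sum_{h=1}^H\mathcal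 D(\pi,M,M',h)$. Algorithm. Given a set $\mathcal M$ of models with $M^\star\in\mathcal M$, a policy class $\Pi$, $n\in\mathbb N$, $\epsilon>0$ and $\phi$, DREEM sets $\mathcal M_1=\mathcal M$ and in round $t=1,2,\dots$ takes an exact maximizer $\pi^t\in\Pi$ of $v_{\rm explore}(\cdot,\mathcal M_t)$. If $v_{\rm explore}(\pi^t,\mathcal M_t)\le\epsilon/|\mathcal A|$ it halts in this round. Otherwise it collects, for each $h\le H$, $n$ transitions $(s^{(i)}_{h-1},a^{(i)}_{h-1},s^{(i)}_h)$ with $\pi^t$, computes from them the empirical misfits $$\widetilde{\mathcal W}(\pi^t,M,h)=\sup_{f\in\widetilde{\mathcal F}}\frac1n\sum_{i=1}^n\Big[\mathbb E_{s'\sim P_M(\cdot\mid s^{(i)}_{h-1},a^{(i)}_{h-1})}f(s^{(i)}_{h-1},a^{(i)}_{h-1},s')-f(s^{(i)}_{h-1},a^{(i)}_{h-1},s^{(i)}_h)\Big]$$ for a given class $\widetilde{\mathcal F}$ of test functions, and sets $\mathcal M_{t+1}=\{M\in\mathcal M_t:\widetilde{\mathcal W}(\pi^t,M,h)\le\phi\text{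 for all }1\le h\le H\}$. Rank. For a real matrix $B$ let $\mathrm{rank}(B,\beta)$ be the smallest $k$ such that $B=UV^\top$ with $U,V$ having $k$ columns and $\|u_i\|_2\|v_j\|_2\le\beta$ for all rows $u_i$ of $U$ and $v_j$ of $V$. Let $A_h=(\mathcal W(\pi,M,h))_{\pi\in\Pi,M\in\mathcal M}$, let $\beta$ be such that $\mathrm{rank}(A_h,\beta)$ is defined for all $1\le h\le H$, and put $$d=\max_{1\le h\le H}\mathrm{rank}(A_h,\beta),\qquad \phi=\frac{\epsilon}{24H^2|\mathcal A|^2\sqrt d}.$$ Claim. Suppose that $|\widetilde{\mathcal W}(\pi^t,M,h)-\mathcal W(\pi^t,M,h)|\le\phi$ for every round $t$ in which data is collected, every $1\le h\le H$ and every $M\in\mathcal M$. Then DREEM halts, and the number of its rounds (the one in which it halts included) is at most $$\max\Big\{1,\ \frac{Hd\,\log(\beta/(2\phi))}{\log(5/3)}\Big\}.$$ (If $d=0$, where $\phi$ is not defined by the formula, it halts in the first round.) -/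

import Mathlib

open MeasureTheory ProbabilityTheory
open scoped ENNReal

noncomputable section

namespace DREEM

/-- A transition model: to each state-action pair a probability distribution over next states. -/
structure Model (S A : Type*) [MeasurableSpace S] [MeasurableSpace A] where
  kernel : Kernel (S × A) S
  markov : IsMarkovKernel kernel

attribute [instance] Model.markov

/-- A (randomized, possibly time-dependent) policy: at time step `h`, in state `s`, the action is
drawn from `kernel h s`. A stationary policy is one with `kernel` constant in `h`. -/
structure Policy (S A : Type*) [MeasurableSpace S] [MeasurableSpace A] where
  kernel : ℕ → Kernel S A
  markov : ∀ h, IsMarkovKernel (kernel h)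

attribute [instance] Policy.markov

/-- The environment: the distribution of the initial state `s₀`, the true transition model and the
horizon. (Rewards only affect which policy is returned after halting.) -/
structure Env (S A : Type*) [MeasurableSpace S] [MeasurableSpace A] where
  init : Measure S
  init_prob : IsProbabilityMeasure init
  truth : Model S A
  horizon : ℕ

attribute [instance] Env.init_prob

/-- The total variation norm `‖μ - ν‖` of the difference of two finite measures, normalized as the
`ℓ¹` norm: for discrete measures it is `∑ s, |μ s - ν s|`. -/
def tvNorm {X : Type*} [MeasurableSpace X] (μ ν : Measure X)
    [IsFiniteMeasure μ] [IsFiniteMeasure ν] : ℝ≥0∞ :=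
  (μ.toSignedMeasure - ν.toSignedMeasure).totalVariation Set.univ

section

variable {S A : Type*} [MeasurableSpace S] [MeasurableSpace A]

/-- The distribution of the state at time step `h` when actions are drawn from `π` and transitions
from `M`. -/
def stateDist (E : Env S A) (M : Model S A) (π : Policy S A) : ℕ → Measure S
  | 0 => E.init
  | h + 1 => (stateDist E M π h ⊗ₘ π.kernel h).bind M.kernel

instance stateDist_prob (E : Env S A) (M : Model S A) (π : Policy S A) (h : ℕ) :
    IsProbabilityMeasure (stateDist E M π h) := by
  induction h with
  | zero => exact E.init_prob
  | succ h ih => rw [stateDist]; infer_instance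

/-- The empirical misfit of `M`, computed from a dataset of `n` transitions
`((s_{h-1}, a_{h-1}), s_h)` with a class `F` of test functions: the supremum over `f ∈ F` of the
average of `E_{s' ∼ P_M(· | s_{h-1}, a_{h-1})} f (s_{h-1}, a_{h-1}, s') - f (s_{h-1}, a_{h-1}, s_h)`
over the dataset. -/
def empiricalMisfit {n : ℕ} (F : Set ((S × A) × S → ℝ)) (D : Fin n → (S × A) × S)
    (M : Model S A) : ℝ :=
  sSup ((fun f : (S × A) × S → ℝ =>
    (∑ i, ((∫ s', f ((D i).1, s') ∂(M.kernel (D i).1)) - f (D i))) / (n : ℝ)) '' F)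

variable [Fintype A] [Nonempty A]

/-- The law of `(s_{h-1}, a_{h-1})` when the first `h - 1` steps follow `π` in model `M` and the
last action is uniform. Only used for `h ≥ 1`. -/
def rollIn (E : Env S A) (M : Model S A) (π : Policy S A) (h : ℕ) : Measure (S × A) :=
  (stateDist E M π (h - 1)).prod (PMF.uniformOfFintype A).toMeasure

instance rollIn_prob (E : Env S A) (M : Model S A) (π : Policy S A) (h : ℕ) :
    IsProbabilityMeasure (rollIn E M π h) := by
  unfold rollIn; infer_instance

/-- The misfit of model `M` discovered by policy `π` at time step `h`. -/
def misfit (E : Env S A) (π : Policy S A) (M : Model S A) (h : ℕ) : ℝ :=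
  (∫⁻ x, tvNorm (M.kernel x) (E.truth.kernel x) ∂(rollIn E E.truth π h)).toReal

/-- The disagreement between `M` and `M'` induced by `π` at time step `h`: the `ℓ¹` distance of the
two laws of `(s_{h-1}, a_{h-1}, s_h)`, the last action being uniform. -/
def disagreement (E : Env S A) (π : Policy S A) (M M' : Model S A) (h : ℕ) : ℝ≥0∞ :=
  tvNorm (rollIn E M π h ⊗ₘ M.kernel) (rollIn E M' π h ⊗ₘ M'.kernel)

/-- The exploration value of `π` for a set of models. -/
def vExplore (E : Env S A) (π : Policy S A) (𝓜 : Set (Model S A)) : ℝ≥0∞ :=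
  ⨆ M ∈ 𝓜, ⨆ M' ∈ 𝓜, ∑ h ∈ Finset.Icc 1 E.horizon, disagreement E π M M' h

/-- The model misfit matrix `A_h`. -/
def misfitMatrix (E : Env S A) (Pi : Set (Policy S A)) (𝓜 : Set (Model S A)) (h : ℕ) :
    Matrix Pi 𝓜 ℝ :=
  fun π M => misfit E π M h

end

/-- `B = U Vᵀ` with `k` columns in `U` and `V`, and `‖uᵢ‖₂ ‖vⱼ‖₂ ≤ β` for all rows `uᵢ`, `vⱼ`. -/
def HasFactorization {m n : Type*} (B : Matrix m n ℝ) (β : ℝ) (k : ℕ) : Prop :=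
  ∃ (U : m → EuclideanSpace ℝ (Fin k)) (V : n → EuclideanSpace ℝ (Fin k)),
    (∀ i j, B i j = inner ℝ (U i) (V j)) ∧ ∀ i j, ‖U i‖ * ‖V j‖ ≤ β

/-- `rank(B, β)`: the smallest inner dimension of such a factorization. -/
def boundedRank {m n : Type*} (B : Matrix m n ℝ) (β : ℝ) : ℕ :=
  sInf {k | HasFactorization B β k}

/-- The inputs of the algorithm: initial model set, policy class, number of trajectories per round,
exploration tolerance, elimination threshold, and the test functions used to compute the empirical
misfits. -/
structure Inputs (S A : Type*) [MeasurableSpace S] [MeasurableSpace A] where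
  models : Set (Model S A)
  policies : Set (Policy S A)
  n : ℕ
  ε : ℝ
  φ : ℝ
  tests : Set ((S × A) × S → ℝ)

/-- The choices and observations made along an execution, with rounds numbered `0, 1, 2, …`: the
exploration policy of round `t`, and the transitions `((s_{h-1}, a_{h-1}), s_h)`, for each time step
`h`, of the dataset collected in round `t`. The entries after the round in which the algorithm
halts are never used. -/
structure Trace {S A : Type*} [MeasurableSpace S] [MeasurableSpace A] (I : Inputs S A) where
  policy : ℕ → Policy S A
  data : ℕ → ℕ → Fin I.n → (S × A) × S

section

variable {S A : Type*} [MeasurableSpace S] [MeasurableSpace A]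

/-- The empirical misfit of `M` at time step `h` from the data collected in round `t`. -/
def Trace.empMisfit {I : Inputs S A} (R : Trace I) (t : ℕ) (M : Model S A) (h : ℕ) : ℝ :=
  empiricalMisfit I.tests (R.data t h) M

/-- The set of models at the beginning of round `t`: each round keeps the models whose empirical
misfit is at most `φ` at every time step. -/
def Trace.modelSet (E : Env S A) {I : Inputs S A} (R : Trace I) : ℕ → Set (Model S A)
  | 0 => I.models
  | t + 1 => {M ∈ R.modelSet E t | ∀ h ∈ Finset.Icc 1 E.horizon, R.empMisfit t M h ≤ I.φ}

variable [Fintype A] [Nonempty A]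

/-- The test in round `t` is passed, so that the algorithm explores (and updates the model set)
instead of halting. -/
def Trace.Explores (E : Env S A) {I : Inputs S A} (R : Trace I) (t : ℕ) : Prop :=
  ENNReal.ofReal (I.ε / Fintype.card A) < vExplore E (R.policy t) (R.modelSet E t)

/-- Round `t` is executed: the algorithm did not halt in an earlier round. -/
def Trace.Reaches (E : Env S A) {I : Inputs S A} (R : Trace I) (t : ℕ) : Prop :=
  ∀ r < t, R.Explores E r

/-- The trace is an execution of the algorithm: in every executed round the exploration policy is an
exact maximizer of the exploration value over the policy class. -/
def Trace.IsExecution (E : Env S A) {I : Inputs S A} (R : Trace I) : Prop :=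
  ∀ t, R.Reaches E t → R.policy t ∈ I.policies ∧
    ∀ π ∈ I.policies, vExplore E π (R.modelSet E t) ≤ vExplore E (R.policy t) (R.modelSet E t)

/-- All empirical misfits computed during the execution are within `φ` of the true ones. -/
def Trace.Accurate (E : Env S A) {I : Inputs S A} (R : Trace I) : Prop :=
  ∀ t, R.Reaches E t → R.Explores E t → ∀ h ∈ Finset.Icc 1 E.horizon, ∀ M ∈ I.models,
    |R.empMisfit t M h - misfit E (R.policy t) M h| ≤ I.φ

/-- The algorithm halts, and it does so in its `N`-th round (so `N - 1` rounds of exploration are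
followed by the round in which it halts). -/
def Trace.HaltsWithRounds (E : Env S A) {I : Inputs S A} (R : Trace I) (N : ℕ) : Prop :=
  ∃ t, N = t + 1 ∧ R.Reaches E t ∧ ¬ R.Explores E t

end

end DREEM

end

/-!
In a round that explores, the surviving models disagree by more than `ε / |A|`. Comparing both
models with the true one, and charging each step of the roll-in at most `|A|` times the misfit at
that step (a uniform action covers every policy up to the factor `|A|`), one of them has misfit
greater than `ε / (2 H² |A|²) = 12 √d φ` at some time step. By pigeonhole some time step `h` serves
at least `T / H` of the first `T` rounds.

For this `h`, factor the misfit matrix through `ℝᵏ`, `k ≤ d`. A model surviving to a later round had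
empirical misfit at most `φ`, hence misfit at most `2 φ`, so its vector lies in the slab of
half-width `2 φ` cut out by the policy of each earlier round, while the model found in the current
round lies at six times `√k` this width. Enclosing the part of a ball cut out by the slabs in
ellipsoids, each such round multiplies the determinant of the quadratic form by at least
`(1 + 6²) / e`, whereas its trace stays bounded by the constant that the ball and the policy
vectors determine. By `det ≤ trace ^ k`, the number of rounds is at most logarithmic in
`β / (2 φ)`.
-/

namespace DREEM

section Ellipsoid

open Matrix

variable {n : Type*} [Fintype n]

/-- The ellipsoid `{v | vᵀ L v ≤ 1}`, for a positive definite matrix `L`. It over-approximates the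
set of models, seen as vectors, that are still consistent with the data. -/
def ellipsoid (L : Matrix n n ℝ) : Set (n → ℝ) :=
  {v | v ⬝ᵥ L *ᵥ v ≤ 1}

/-- The slab of half-width `b` orthogonal to `u`. It is the constraint that a round of exploration
puts on the remaining models. -/
def slab (u : n → ℝ) (b : ℝ) : Set (n → ℝ) :=
  {v | |u ⬝ᵥ v| ≤ b}

/-- The matrix of an ellipsoid that contains the intersection of `ellipsoid L` and `slab u b`. The
quadratic forms of the two constraints are averaged with the weights `k / (k + 1)` and
`1 / (k + 1)`, where `k` is the dimension. -/
noncomputable def slabUpdate (L : Matrix n n ℝ) (u : n → ℝ) (b : ℝ) : Matrix n n ℝ :=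
  (Fintype.card n / (Fintype.card n + 1) : ℝ) •
    (L + (1 / (Fintype.card n * b ^ 2)) • vecMulVec u u)

theorem posDef_slabUpdate [Nonempty n] {L : Matrix n n ℝ} (hL : L.PosDef) (u : n → ℝ) (b : ℝ) :
    (slabUpdate L u b).PosDef := by
  have hu : (vecMulVec u u).PosSemidef := by simpa using posSemidef_vecMulVec_self_star u
  exact (hL.add_posSemidef (hu.smul (by positivity))).smul (by positivity)

theorem trace_slabUpdate_le [Nonempty n] {L : Matrix n n ℝ} {u : n → ℝ} {b C : ℝ} (hb : b ≠ 0)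
    (hL : L.trace ≤ C) (hu : u ⬝ᵥ u ≤ C * b ^ 2) : (slabUpdate L u b).trace ≤ C := by
  rw [slabUpdate, trace_smul, trace_add, trace_smul, trace_vecMulVec, smul_eq_mul, smul_eq_mul]
  set k : ℝ := (Fintype.card n : ℝ)
  have hk0 : 0 < k := by positivity
  calc k / (k + 1) * (L.trace + 1 / (k * b ^ 2) * (u ⬝ᵥ u))
      ≤ k / (k + 1) * (C + 1 / (k * b ^ 2) * (C * b ^ 2)) := by gcongr
    _ = C := by field_simp

theorem ellipsoid_inter_slab_subset [Nonempty n] (L : Matrix n n ℝ) (u : n → ℝ) {b : ℝ}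
    (hb : 0 < b) : ellipsoid L ∩ slab u b ⊆ ellipsoid (slabUpdate L u b) := by
  rintro v ⟨hvL : v ⬝ᵥ L *ᵥ v ≤ 1, hvu : |u ⬝ᵥ v| ≤ b⟩
  have hform : v ⬝ᵥ vecMulVec u u *ᵥ v = (u ⬝ᵥ v) ^ 2 := by
    simp [vecMulVec_mulVec, dotProduct_comm v u, sq]
  have hsq : (u ⬝ᵥ v) ^ 2 ≤ b ^ 2 := sq_le_sq' (abs_le.1 hvu).1 (abs_le.1 hvu).2
  change v ⬝ᵥ slabUpdate L u b *ᵥ v ≤ 1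
  rw [slabUpdate, smul_mulVec, add_mulVec, smul_mulVec, dotProduct_smul, dotProduct_add,
    dotProduct_smul, hform, smul_eq_mul, smul_eq_mul]
  set k : ℝ := (Fintype.card n : ℝ)
  have hk0 : 0 < k := by positivity
  calc k / (k + 1) * (v ⬝ᵥ L *ᵥ v + 1 / (k * b ^ 2) * (u ⬝ᵥ v) ^ 2)
      ≤ k / (k + 1) * (1 + 1 / (k * b ^ 2) * b ^ 2) := by gcongr
    _ = 1 := by field_simp

section Determinant

variable [DecidableEq n]

theorem det_le_trace_pow {L : Matrix n n ℝ} (hL : L.PosSemidef) :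
    L.det ≤ L.trace ^ Fintype.card n := by
  have hdet : L.det = ∏ i, hL.1.eigenvalues i := by simpa using hL.1.det_eq_prod_eigenvalues
  have htrace : L.trace = ∑ i, hL.1.eigenvalues i := by simpa using hL.1.trace_eq_sum_eigenvalues
  rw [hdet, htrace, ← Finset.card_univ, ← Finset.prod_const]
  exact Finset.prod_le_prod (fun i _ => hL.eigenvalues_nonneg i) fun i hi =>
    Finset.single_le_sum (fun j _ => hL.eigenvalues_nonneg j) hi

theorem det_add_smul_vecMulVec {L : Matrix n n ℝ} (hL : IsUnit L.det) (c : ℝ) (u : n → ℝ) :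
    (L + c • vecMulVec u u).det = L.det * (1 + c * (u ⬝ᵥ L⁻¹ *ᵥ u)) := by
  rw [← smul_vecMulVec, vecMulVec_eq Unit, det_add_replicateCol_mul_replicateRow hL,
    det_unique (n := Unit), Matrix.add_apply, one_apply_eq, Matrix.mul_assoc, ← replicateCol_mulVec,
    replicateRow_mul_replicateCol_apply, mulVec_smul, dotProduct_smul, smul_eq_mul]

theorem sq_dotProduct_le {L : Matrix n n ℝ} (hL : L.PosDef) (u v : n → ℝ) :
    (u ⬝ᵥ v) ^ 2 ≤ (u ⬝ᵥ L⁻¹ *ᵥ u) * (v ⬝ᵥ L *ᵥ v) := by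
  have hLT : Lᵀ = L := by rw [← conjTranspose_eq_transpose_of_trivial]; exact hL.1.eq
  have hinv : L *ᵥ (L⁻¹ *ᵥ u) = u := by
    rw [mulVec_mulVec, mul_nonsing_inv _ hL.det_pos.ne'.isUnit, one_mulVec]
  have hcs := LinearMap.BilinForm.apply_sq_le_of_symm (toBilin' L)
    (fun x => by simpa [toBilin'_apply'] using hL.posSemidef.dotProduct_mulVec_nonneg x)
    ⟨fun x y => by
      rw [toBilin'_apply', toBilin'_apply', dotProduct_mulVec, ← mulVec_transpose, hLT,
        dotProduct_comm]; rfl⟩ (L⁻¹ *ᵥ u) v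
  have huv : (L⁻¹ *ᵥ u) ⬝ᵥ L *ᵥ v = u ⬝ᵥ v := by
    rw [dotProduct_mulVec, ← mulVec_transpose, hLT, hinv]
  simpa only [toBilin'_apply', huv, hinv, dotProduct_comm _ u] using hcs

theorem exp_neg_one_le_div_add_one_pow (k : ℕ) : Real.exp (-1) ≤ ((k : ℝ) / (k + 1)) ^ k := by
  rcases k.eq_zero_or_pos with rfl | hk
  · simp
  have hinv : ((k : ℝ) / (k + 1)) ^ k = ((1 + (k : ℝ)⁻¹) ^ k)⁻¹ := by
    rw [← inv_pow]; congr 1; field_simp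
  rw [hinv, Real.exp_neg]
  exact inv_anti₀ (by positivity) Real.one_add_inv_pow_le_exp

/-- By Cauchy–Schwarz for the form `L`, the point `w` far outside the slab forces `uᵀ L⁻¹ u` to be
large, hence so is the rank-one update. -/
theorem mul_det_le_det_slabUpdate [Nonempty n] {L : Matrix n n ℝ} (hL : L.PosDef)
    {u w : n → ℝ} {b γ : ℝ} (hb : 0 < b) (hγ : 0 ≤ γ) (hw : w ∈ ellipsoid L)
    (huw : γ * √(Fintype.card n) * b ≤ |u ⬝ᵥ w|) :
    (1 + γ ^ 2) * Real.exp (-1) * L.det ≤ (slabUpdate L u b).det := by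
  set k : ℝ := (Fintype.card n : ℝ)
  have hk0 : 0 < k := by positivity
  have hinv : 0 ≤ u ⬝ᵥ L⁻¹ *ᵥ u := by
    simpa using hL.inv.posSemidef.dotProduct_mulVec_nonneg u
  have hquad : γ ^ 2 * (k * b ^ 2) ≤ u ⬝ᵥ L⁻¹ *ᵥ u :=
    calc γ ^ 2 * (k * b ^ 2) = (γ * √k * b) ^ 2 := by
          rw [mul_pow, mul_pow, Real.sq_sqrt hk0.le]; ring
      _ ≤ |u ⬝ᵥ w| ^ 2 := by gcongr
      _ ≤ (u ⬝ᵥ L⁻¹ *ᵥ u) * (w ⬝ᵥ L *ᵥ w) := by rw [sq_abs]; exact sq_dotProduct_le hL u w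
      _ ≤ u ⬝ᵥ L⁻¹ *ᵥ u := mul_le_of_le_one_right hinv hw
  have hγk : γ ^ 2 ≤ 1 / (k * b ^ 2) * (u ⬝ᵥ L⁻¹ *ᵥ u) := by
    rwa [one_div_mul_eq_div, le_div_iff₀ (by positivity)]
  rw [slabUpdate, det_smul, det_add_smul_vecMulVec hL.det_pos.ne'.isUnit]
  calc (1 + γ ^ 2) * Real.exp (-1) * L.det = Real.exp (-1) * (L.det * (1 + γ ^ 2)) := by ring
    _ ≤ (k / (k + 1)) ^ Fintype.card n * (L.det * (1 + 1 / (k * b ^ 2) * (u ⬝ᵥ L⁻¹ *ᵥ u))) := by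
        have := hL.det_pos.le
        gcongr
        exact exp_neg_one_le_div_add_one_pow _

theorem exists_ellipsoid_of_slabs [Nonempty n] {ι : Type*} [LinearOrder ι]
    {L₀ : Matrix n n ℝ} (hL₀ : L₀.PosDef) {b γ C : ℝ} (hb : 0 < b) (hγ : 0 ≤ γ)
    (hC : L₀.trace ≤ C) {u w : ι → n → ℝ} {s : Finset ι}
    (hu : ∀ i ∈ s, u i ⬝ᵥ u i ≤ C * b ^ 2) (hw : ∀ i ∈ s, w i ∈ ellipsoid L₀)
    (hlt : ∀ i ∈ s, ∀ j ∈ s, i < j → w j ∈ slab (u i) b)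
    (hdiag : ∀ i ∈ s, γ * √(Fintype.card n) * b ≤ |u i ⬝ᵥ w i|) :
    ∃ L : Matrix n n ℝ, L.PosDef ∧ L.trace ≤ C ∧
      ((1 + γ ^ 2) * Real.exp (-1)) ^ s.card * L₀.det ≤ L.det ∧
      ellipsoid L₀ ∩ ⋂ i ∈ s, slab (u i) b ⊆ ellipsoid L := by
  induction s using Finset.induction_on_max with
  | empty => exact ⟨L₀, hL₀, hC, by simp, by simp⟩
  | insert a s hmax ih =>
    simp only [Finset.forall_mem_insert] at hu hw hdiag
    have hmem {i} (hi : i ∈ s) : i ∈ insert a s := Finset.mem_insert_of_mem hi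
    obtain ⟨L, hL, htrace, hdet, hsub⟩ := ih hu.2 hw.2
      (fun i hi j hj => hlt i (hmem hi) j (hmem hj)) hdiag.2
    have hwa : w a ∈ ellipsoid L := hsub ⟨hw.1, Set.mem_iInter₂.2 fun i hi =>
      hlt i (hmem hi) a (Finset.mem_insert_self a s) (hmax i hi)⟩
    refine ⟨slabUpdate L (u a) b, posDef_slabUpdate hL _ _,
      trace_slabUpdate_le hb.ne' htrace hu.1, ?_, ?_⟩
    · rw [Finset.card_insert_of_notMem fun ha => (hmax a ha).false, pow_succ']
      calc (1 + γ ^ 2) * Real.exp (-1) * ((1 + γ ^ 2) * Real.exp (-1)) ^ s.card * L₀.det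
          ≤ (1 + γ ^ 2) * Real.exp (-1) * L.det := by rw [mul_assoc]; gcongr
        _ ≤ (slabUpdate L (u a) b).det := mul_det_le_det_slabUpdate hL hb hγ hwa hdiag.1
    · rw [Finset.set_biInter_insert, Set.inter_comm (slab (u a) b), ← Set.inter_assoc]
      exact (Set.inter_subset_inter_left _ hsub).trans (ellipsoid_inter_slab_subset L (u a) hb)

end Determinant

/-- The volume argument: every `i ∈ s` cuts the ellipsoid down by a constant factor, and the volume
stays bounded from below because the trace stays bounded from above. -/
theorem card_mul_le_mul_log_of_dotProduct [Nonempty n] {ι : Type*} [LinearOrder ι] {b γ ρ r : ℝ}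
    (hb : 0 < b) (hγ : 0 ≤ γ) (hr : 0 < r)
    (hbr : Fintype.card n * b ^ 2 ≤ (ρ * r) ^ 2) {u w : ι → n → ℝ} {s : Finset ι}
    (hu : ∀ i ∈ s, u i ⬝ᵥ u i ≤ ρ ^ 2) (hw : ∀ i ∈ s, w i ⬝ᵥ w i ≤ r ^ 2)
    (hlt : ∀ i ∈ s, ∀ j ∈ s, i < j → |u i ⬝ᵥ w j| ≤ b)
    (hdiag : ∀ i ∈ s, γ * √(Fintype.card n) * b ≤ |u i ⬝ᵥ w i|) :
    s.card * (Real.log (1 + γ ^ 2) - 1) ≤ 2 * Fintype.card n * Real.log (ρ * r / b) := by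
  classical
  have hball : ((r ^ 2)⁻¹ • (1 : Matrix n n ℝ)).PosDef := PosDef.one.smul (by positivity)
  obtain ⟨L, hL, htrace, hdet, -⟩ := exists_ellipsoid_of_slabs hball (C := (ρ / b) ^ 2) hb hγ
    (by
      rw [trace_smul, trace_one, smul_eq_mul, inv_mul_le_iff₀ (by positivity), div_pow,
        mul_div_assoc', le_div_iff₀ (by positivity)]
      linarith)
    (fun i hi => by rw [← mul_pow, div_mul_cancel₀ _ hb.ne']; exact hu i hi)
    (fun i hi => by
      change w i ⬝ᵥ ((r ^ 2)⁻¹ • (1 : Matrix n n ℝ)) *ᵥ w i ≤ 1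
      rw [smul_mulVec, one_mulVec, dotProduct_smul, smul_eq_mul, inv_mul_le_iff₀ (by positivity),
        mul_one]
      exact hw i hi)
    hlt hdiag
  have hpow : ((1 + γ ^ 2) * Real.exp (-1)) ^ s.card ≤ (ρ * r / b) ^ (2 * Fintype.card n) := by
    have hle := hdet.trans <| (det_le_trace_pow hL.posSemidef).trans <|
      pow_le_pow_left₀ hL.posSemidef.trace_nonneg htrace _
    rw [det_smul, det_one, mul_one, inv_pow, ← div_eq_mul_inv, div_le_iff₀ (by positivity)] at hle
    calc ((1 + γ ^ 2) * Real.exp (-1)) ^ s.card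
        ≤ ((ρ / b) ^ 2) ^ Fintype.card n * (r ^ 2) ^ Fintype.card n := hle
      _ = (ρ * r / b) ^ (2 * Fintype.card n) := by rw [← mul_pow, ← mul_pow, ← pow_mul]; ring
  have hlog := Real.log_le_log (by positivity) hpow
  rw [Real.log_pow, Real.log_pow, Real.log_mul (by positivity) (by positivity), Real.log_exp]
    at hlog
  push_cast at hlog
  linarith

theorem card_mul_le_mul_log {ι : Type*} [LinearOrder ι] {b β γ : ℝ} (hb : 0 < b) (hγ : 1 ≤ γ)
    {u w : ι → EuclideanSpace ℝ n} {s : Finset ι} (hs : s.Nonempty)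
    (huw : ∀ i ∈ s, ∀ j ∈ s, ‖u i‖ * ‖w j‖ ≤ β)
    (hlt : ∀ i ∈ s, ∀ j ∈ s, i < j → |inner ℝ (u i) (w j)| ≤ b)
    (hdiag : ∀ i ∈ s, γ * √(Fintype.card n) * b < |inner ℝ (u i) (w i)|) :
    s.card * (Real.log (1 + γ ^ 2) - 1) ≤ 2 * Fintype.card n * Real.log (β / b) := by
  obtain ⟨m, hm, hmax⟩ := s.exists_max_image (fun i => ‖w i‖) hs
  have hpos : 0 < |inner ℝ (u m) (w m)| := lt_of_le_of_lt (by positivity) (hdiag m hm)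
  have hle : |inner ℝ (u m) (w m)| ≤ β := (abs_real_inner_le_norm _ _).trans (huw m hm m hm)
  have hw0 : w m ≠ 0 := fun h => by simp [h] at hpos
  have hr : 0 < ‖w m‖ := norm_pos_iff.2 hw0
  have hn : Nonempty n := not_isEmpty_iff.1 fun _ => hw0 (Subsingleton.elim _ _)
  have hdot (x y : EuclideanSpace ℝ n) : x.ofLp ⬝ᵥ y.ofLp = inner ℝ x y := by
    simp [EuclideanSpace.inner_eq_star_dotProduct, dotProduct_comm]
  have hβ : β / ‖w m‖ * ‖w m‖ = β := div_mul_cancel₀ _ hr.ne'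
  have hbβ : Fintype.card n * b ^ 2 ≤ β ^ 2 :=
    calc Fintype.card n * b ^ 2 = (1 * √(Fintype.card n) * b) ^ 2 := by
          rw [one_mul, mul_pow, Real.sq_sqrt (Nat.cast_nonneg _)]
      _ ≤ (γ * √(Fintype.card n) * b) ^ 2 := by gcongr
      _ ≤ β ^ 2 := by gcongr; exact (hdiag m hm).le.trans hle
  have := card_mul_le_mul_log_of_dotProduct (γ := γ) (ρ := β / ‖w m‖) (u := fun i => (u i).ofLp)
    (w := fun i => (w i).ofLp) (s := s) hb (zero_le_one.trans hγ)
    hr (by rwa [hβ])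
    (fun i hi => by
      rw [hdot, real_inner_self_eq_norm_sq]
      gcongr
      exact (le_div_iff₀ hr).2 (huw i hi m hm))
    (fun i hi => by
      rw [hdot, real_inner_self_eq_norm_sq]
      gcongr
      exact hmax i hi)
    (fun i hi j hj hij => by rw [hdot]; exact hlt i hi j hj hij)
    (fun i hi => by rw [hdot]; exact (hdiag i hi).le)
  rwa [hβ] at this

end Ellipsoid

section Factorization

variable {m n : Type*} {B : Matrix m n ℝ} {β : ℝ} {k : ℕ}

theorem hasFactorization_boundedRank (h : ∃ k, HasFactorization B β k) :
    HasFactorization B β (boundedRank B β) :=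
  Nat.sInf_mem (s := {k | HasFactorization B β k}) h

theorem HasFactorization.pos (hB : HasFactorization B β k) {i : m} {j : n} (hij : B i j ≠ 0) :
    0 < k := by
  obtain ⟨U, V, hUV, -⟩ := hB
  rcases k.eq_zero_or_pos with rfl | hk
  · exact absurd ((hUV i j).trans (by rw [Subsingleton.elim (U i) 0, inner_zero_left])) hij
  · exact hk

theorem HasFactorization.card_mul_le_mul_log (hB : HasFactorization B β k) {ι : Type*}
    [LinearOrder ι] {b γ : ℝ} (hb : 0 < b) (hγ : 1 ≤ γ) {row : ι → m} {col : ι → n}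
    {s : Finset ι} (hs : s.Nonempty)
    (hlt : ∀ i ∈ s, ∀ j ∈ s, i < j → |B (row i) (col j)| ≤ b)
    (hdiag : ∀ i ∈ s, γ * √k * b < |B (row i) (col i)|) :
    s.card * (Real.log (1 + γ ^ 2) - 1) ≤ 2 * k * Real.log (β / b) := by
  obtain ⟨U, V, hUV, hnorm⟩ := hB
  simp only [hUV] at hlt hdiag
  simpa using DREEM.card_mul_le_mul_log (u := U ∘ row) (w := V ∘ col) hb hγ hs
    (fun i _ j _ => hnorm (row i) (col j)) hlt (by simpa using hdiag)

end Factorization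

section TotalVariation

variable {X Y : Type*} [MeasurableSpace X] [MeasurableSpace Y]

theorem tvNorm_eq (μ ν : Measure X) [IsFiniteMeasure μ] [IsFiniteMeasure ν] :
    tvNorm μ ν = (μ - ν) Set.univ + (ν - μ) Set.univ := by
  rw [tvNorm, SignedMeasure.totalVariation, Measure.toJordanDecomposition_toSignedMeasure_sub]
  rfl

theorem tvNorm_self (μ : Measure X) [IsFiniteMeasure μ] : tvNorm μ μ = 0 := by
  simp [tvNorm_eq]

theorem tvNorm_comm (μ ν : Measure X) [IsFiniteMeasure μ] [IsFiniteMeasure ν] :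
    tvNorm μ ν = tvNorm ν μ := by
  rw [tvNorm_eq, tvNorm_eq, add_comm]

theorem tvNorm_le_add (μ ν : Measure X) [IsFiniteMeasure μ] [IsFiniteMeasure ν] :
    tvNorm μ ν ≤ μ Set.univ + ν Set.univ := by
  rw [tvNorm_eq]
  exact add_le_add (Measure.sub_le _) (Measure.sub_le _)

theorem le_sub_add (μ ν : Measure X) [IsFiniteMeasure μ] [IsFiniteMeasure ν] : μ ≤ μ - ν + ν :=
  Measure.sub_le_iff_le_add.1 le_rfl

theorem sub_le_sub_add_sub (μ ν ρ : Measure X) [IsFiniteMeasure μ] [IsFiniteMeasure ν]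
    [IsFiniteMeasure ρ] : μ - ρ ≤ (μ - ν) + (ν - ρ) := by
  refine Measure.sub_le_of_le_add ((le_sub_add μ ν).trans ?_)
  rw [add_assoc]
  gcongr
  exact le_sub_add ν ρ

theorem tvNorm_triangle (μ ν ρ : Measure X) [IsFiniteMeasure μ] [IsFiniteMeasure ν]
    [IsFiniteMeasure ρ] : tvNorm μ ρ ≤ tvNorm μ ν + tvNorm ν ρ := by
  simp only [tvNorm_eq]
  calc (μ - ρ) Set.univ + (ρ - μ) Set.univ
      ≤ ((μ - ν) Set.univ + (ν - ρ) Set.univ) + ((ρ - ν) Set.univ + (ν - μ) Set.univ) :=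
        add_le_add (sub_le_sub_add_sub μ ν ρ _) (sub_le_sub_add_sub ρ ν μ _)
    _ = _ := by ring

theorem bind_mono {μ ν : Measure X} (h : μ ≤ ν) (κ : Kernel X Y) : μ.bind κ ≤ ν.bind κ := by
  refine Measure.le_iff.2 fun s hs => ?_
  rw [Measure.bind_apply hs κ.aemeasurable, Measure.bind_apply hs κ.aemeasurable]
  exact lintegral_mono' h le_rfl

theorem bind_sub_bind_le (μ ν : Measure X) [IsFiniteMeasure μ] [IsFiniteMeasure ν]
    (κ : Kernel X Y) : μ.bind κ - ν.bind κ ≤ (μ - ν).bind κ := by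
  refine Measure.sub_le_of_le_add ?_
  rw [← Measure.comp_add]
  exact bind_mono (le_sub_add μ ν) κ

theorem tvNorm_bind_le (μ ν : Measure X) [IsFiniteMeasure μ] [IsFiniteMeasure ν]
    (κ : Kernel X Y) [IsMarkovKernel κ] : tvNorm (μ.bind κ) (ν.bind κ) ≤ tvNorm μ ν := by
  have hmass (ξ : Measure X) : ξ.bind κ Set.univ = ξ Set.univ := by
    simp [Measure.bind_apply MeasurableSet.univ κ.aemeasurable]
  rw [tvNorm_eq, tvNorm_eq, ← hmass (μ - ν), ← hmass (ν - μ)]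
  exact add_le_add (bind_sub_bind_le μ ν κ _) (bind_sub_bind_le ν μ κ _)

theorem tvNorm_compProd_left_le (μ ν : Measure X) [IsFiniteMeasure μ] [IsFiniteMeasure ν]
    (κ : Kernel X Y) [IsMarkovKernel κ] : tvNorm (μ ⊗ₘ κ) (ν ⊗ₘ κ) ≤ tvNorm μ ν := by
  simp only [Measure.compProd_eq_comp_prod]
  exact tvNorm_bind_le μ ν _

theorem tvNorm_prod_left_le (μ ν : Measure X) [IsFiniteMeasure μ] [IsFiniteMeasure ν]
    (ρ : Measure Y) [IsProbabilityMeasure ρ] : tvNorm (μ.prod ρ) (ν.prod ρ) ≤ tvNorm μ ν := by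
  simpa only [Measure.compProd_const] using tvNorm_compProd_left_le μ ν (Kernel.const X ρ)

theorem exists_measurableSet_sub_univ_eq (μ ν : Measure X) [IsFiniteMeasure μ]
    [IsFiniteMeasure ν] : ∃ s, MeasurableSet s ∧ (μ - ν) Set.univ = μ s - ν s := by
  obtain ⟨s, hs⟩ := exists_isHahnDecomposition μ ν
  have hsc := hs.measurableSet.compl
  refine ⟨sᶜ, hsc, ?_⟩
  rw [← measure_add_measure_compl hs.measurableSet,
    Measure.sub_apply_eq_zero_of_isHahnDecomposition hs, zero_add,
    ← Measure.restrict_apply_self, Measure.restrict_sub_eq_restrict_sub_restrict hsc,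
    Measure.sub_apply hsc hs.ge_on_compl, Measure.restrict_apply_self,
    Measure.restrict_apply_self]

/-- The integrand on the right need not be measurable when `Y` is not countably generated, so this
goes through a single set that is optimal for the joint laws. -/
theorem compProd_sub_compProd_univ_le (μ : Measure X) [IsFiniteMeasure μ] (κ η : Kernel X Y)
    [IsFiniteKernel κ] [IsFiniteKernel η] :
    (μ ⊗ₘ κ - μ ⊗ₘ η) Set.univ ≤ ∫⁻ x, (κ x - η x) Set.univ ∂μ := by
  obtain ⟨s, hs, hsub⟩ := exists_measurableSet_sub_univ_eq (μ ⊗ₘ κ) (μ ⊗ₘ η)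
  rw [hsub, Measure.compProd_apply hs, Measure.compProd_apply hs, tsub_le_iff_right,
    ← lintegral_add_right _ (Kernel.measurable_kernel_prodMk_left hs)]
  refine lintegral_mono fun x => (le_sub_add (κ x) (η x) _).trans ?_
  rw [Measure.add_apply]
  gcongr
  exact Set.subset_univ _

theorem tvNorm_compProd_right_le (μ : Measure X) [IsFiniteMeasure μ] (κ η : Kernel X Y)
    [IsFiniteKernel κ] [IsFiniteKernel η] :
    tvNorm (μ ⊗ₘ κ) (μ ⊗ₘ η) ≤ ∫⁻ x, tvNorm (κ x) (η x) ∂μ := by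
  simp only [tvNorm_eq]
  exact (add_le_add (compProd_sub_compProd_univ_le μ κ η)
    (compProd_sub_compProd_univ_le μ η κ)).trans (le_lintegral_add _ _)

theorem tvNorm_bind_right_le (μ : Measure X) [IsFiniteMeasure μ] (κ η : Kernel X Y)
    [IsFiniteKernel κ] [IsFiniteKernel η] :
    tvNorm (μ.bind κ) (μ.bind η) ≤ ∫⁻ x, tvNorm (κ x) (η x) ∂μ := by
  have hsnd (ξ : Kernel X Y) [IsFiniteKernel ξ] :
      (μ ⊗ₘ ξ).bind (Kernel.deterministic Prod.snd measurable_snd : Kernel (X × Y) Y) =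
        μ.bind ξ := by
    rw [Measure.deterministic_comp_eq_map, ← Measure.snd_compProd, Measure.snd]
  simp only [← hsnd κ, ← hsnd η]
  exact (tvNorm_bind_le _ _ _).trans (tvNorm_compProd_right_le μ κ η)

end TotalVariation

section Uniform

variable {S A : Type*} [MeasurableSpace S] [MeasurableSpace A] [Fintype A] [Nonempty A]

theorem measure_le_card_smul_uniform (ν : Measure A) [IsProbabilityMeasure ν] :
    ν ≤ (Fintype.card A : ℝ≥0∞) • (PMF.uniformOfFintype A).toMeasure := by
  classical
  refine Measure.le_iff.2 fun s hs => ?_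
  rw [Measure.smul_apply, smul_eq_mul, PMF.toMeasure_uniformOfFintype_apply s hs,
    ENNReal.mul_div_cancel (by simp) (by simp)]
  rcases s.eq_empty_or_nonempty with rfl | hne
  · simp
  · have := hne.to_subtype
    exact prob_le_one.trans (by exact_mod_cast Fintype.card_pos (α := s))

theorem compProd_le_card_smul_prod_uniform (μ : Measure S) [SFinite μ] (π : Kernel S A)
    [IsMarkovKernel π] :
    μ ⊗ₘ π ≤ (Fintype.card A : ℝ≥0∞) • μ.prod (PMF.uniformOfFintype A).toMeasure := by
  refine Measure.le_iff.2 fun s hs => ?_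
  rw [Measure.smul_apply, Measure.compProd_apply hs, Measure.prod_apply hs, smul_eq_mul,
    ← lintegral_const_mul _ (measurable_measure_prodMk_left hs)]
  exact lintegral_mono fun x => measure_le_card_smul_uniform (π x) _

end Uniform

section Simulation

variable {S A : Type*} [MeasurableSpace S] [MeasurableSpace A] [Fintype A] [Nonempty A]
  (E : Env S A) (π : Policy S A) (M M' : Model S A)

theorem misfit_nonneg (h : ℕ) : 0 ≤ misfit E π M h :=
  ENNReal.toReal_nonneg

theorem ofReal_misfit (h : ℕ) :
    ENNReal.ofReal (misfit E π M h) =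
      ∫⁻ x, tvNorm (M.kernel x) (E.truth.kernel x) ∂(rollIn E E.truth π h) := by
  refine ENNReal.ofReal_toReal (ne_top_of_le_ne_top (b := 2) (by simp) ?_)
  calc ∫⁻ x, tvNorm (M.kernel x) (E.truth.kernel x) ∂(rollIn E E.truth π h)
      ≤ ∫⁻ _, 2 ∂(rollIn E E.truth π h) := lintegral_mono fun x =>
        (tvNorm_le_add _ _).trans_eq (by simp [one_add_one_eq_two])
    _ = 2 := by simp

theorem tvNorm_stateDist_le (h : ℕ) :
    tvNorm (stateDist E M π h) (stateDist E E.truth π h) ≤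
      Fintype.card A * ∑ k ∈ Finset.Icc 1 h, ENNReal.ofReal (misfit E π M k) := by
  induction h with
  | zero => exact (tvNorm_self E.init).trans_le zero_le
  | succ h ih =>
    set ξ := stateDist E E.truth π h ⊗ₘ π.kernel h
    have hpast : tvNorm ((stateDist E M π h ⊗ₘ π.kernel h).bind M.kernel) (ξ.bind M.kernel) ≤
        Fintype.card A * ∑ k ∈ Finset.Icc 1 h, ENNReal.ofReal (misfit E π M k) :=
      (tvNorm_bind_le _ _ _).trans ((tvNorm_compProd_left_le _ _ _).trans ih)
    have hstep : tvNorm (ξ.bind M.kernel) (ξ.bind E.truth.kernel) ≤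
        Fintype.card A * ENNReal.ofReal (misfit E π M (h + 1)) :=
      calc tvNorm (ξ.bind M.kernel) (ξ.bind E.truth.kernel)
          ≤ ∫⁻ x, tvNorm (M.kernel x) (E.truth.kernel x) ∂ξ := tvNorm_bind_right_le _ _ _
        _ ≤ ∫⁻ x, tvNorm (M.kernel x) (E.truth.kernel x)
              ∂((Fintype.card A : ℝ≥0∞) • rollIn E E.truth π (h + 1)) :=
            lintegral_mono' (compProd_le_card_smul_prod_uniform _ _) le_rfl
        _ = Fintype.card A * ENNReal.ofReal (misfit E π M (h + 1)) := by
            rw [lintegral_smul_measure, ofReal_misfit, smul_eq_mul]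
    rw [Finset.sum_Icc_succ_top (by omega), mul_add]
    exact (tvNorm_triangle _ (ξ.bind M.kernel) _).trans (add_le_add hpast hstep)

theorem disagreement_comm (h : ℕ) : disagreement E π M M' h = disagreement E π M' M h :=
  tvNorm_comm _ _

theorem disagreement_triangle (M'' : Model S A) (h : ℕ) :
    disagreement E π M M'' h ≤ disagreement E π M M' h + disagreement E π M' M'' h :=
  tvNorm_triangle _ _ _

theorem disagreement_truth_le {h : ℕ} (hh : 1 ≤ h) :
    disagreement E π M E.truth h ≤
      Fintype.card A * ∑ k ∈ Finset.Icc 1 h, ENNReal.ofReal (misfit E π M k) := by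
  obtain ⟨h, rfl⟩ := Nat.exists_eq_add_of_le' hh
  have hpast : tvNorm (rollIn E M π (h + 1) ⊗ₘ M.kernel)
      (rollIn E E.truth π (h + 1) ⊗ₘ M.kernel) ≤
        Fintype.card A * ∑ k ∈ Finset.Icc 1 h, ENNReal.ofReal (misfit E π M k) :=
    (tvNorm_compProd_left_le _ _ _).trans <|
      (tvNorm_prod_left_le _ _ _).trans (tvNorm_stateDist_le E π M h)
  have hstep : tvNorm (rollIn E E.truth π (h + 1) ⊗ₘ M.kernel)
      (rollIn E E.truth π (h + 1) ⊗ₘ E.truth.kernel) ≤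
        Fintype.card A * ENNReal.ofReal (misfit E π M (h + 1)) := by
    refine (tvNorm_compProd_right_le _ _ _).trans ?_
    rw [ofReal_misfit]
    exact le_mul_of_one_le_left' (by exact_mod_cast Fintype.card_pos (α := A))
  rw [Finset.sum_Icc_succ_top (by omega), mul_add]
  exact (tvNorm_triangle _ (rollIn E E.truth π (h + 1) ⊗ₘ M.kernel) _).trans
    (add_le_add hpast hstep)

variable {E π M}

theorem sum_disagreement_truth_le {δ : ℝ}
    (hδ : ∀ h ∈ Finset.Icc 1 E.horizon, misfit E π M h ≤ δ) :
    ∑ h ∈ Finset.Icc 1 E.horizon, disagreement E π M E.truth h ≤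
      ENNReal.ofReal ((E.horizon : ℝ) ^ 2 * Fintype.card A * δ) := by
  have hsum : ∑ k ∈ Finset.Icc 1 E.horizon, ENNReal.ofReal (misfit E π M k) ≤
      E.horizon * ENNReal.ofReal δ := by
    simpa using Finset.sum_le_card_nsmul _ _ _ fun k hk => ENNReal.ofReal_le_ofReal (hδ k hk)
  calc ∑ h ∈ Finset.Icc 1 E.horizon, disagreement E π M E.truth h
      ≤ ∑ _h ∈ Finset.Icc 1 E.horizon, Fintype.card A * (E.horizon * ENNReal.ofReal δ) := by
        refine Finset.sum_le_sum fun h hh => ?_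
        obtain ⟨hh1, hhH⟩ := Finset.mem_Icc.1 hh
        refine (disagreement_truth_le E π M hh1).trans ?_
        gcongr
        exact (Finset.sum_le_sum_of_subset (Finset.Icc_subset_Icc_right hhH)).trans hsum
    _ = ENNReal.ofReal ((E.horizon : ℝ) ^ 2 * Fintype.card A * δ) := by
        rw [ENNReal.ofReal_mul (by positivity), ENNReal.ofReal_mul (by positivity),
          ENNReal.ofReal_pow (by positivity), ENNReal.ofReal_natCast, ENNReal.ofReal_natCast,
          Finset.sum_const, Nat.card_Icc, Nat.add_sub_cancel, nsmul_eq_mul]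
        ring

theorem vExplore_le {𝓜 : Set (Model S A)} {δ : ℝ}
    (hδ : ∀ M ∈ 𝓜, ∀ h ∈ Finset.Icc 1 E.horizon, misfit E π M h ≤ δ) :
    vExplore E π 𝓜 ≤ ENNReal.ofReal (2 * (E.horizon : ℝ) ^ 2 * Fintype.card A * δ) := by
  refine iSup₂_le fun M hM => iSup₂_le fun M' hM' => ?_
  calc ∑ h ∈ Finset.Icc 1 E.horizon, disagreement E π M M' h
      ≤ ∑ h ∈ Finset.Icc 1 E.horizon,
          (disagreement E π M E.truth h + disagreement E π M' E.truth h) := by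
        refine Finset.sum_le_sum fun h _ => ?_
        rw [disagreement_comm E π M']
        exact disagreement_triangle E π M E.truth M' h
    _ ≤ ENNReal.ofReal ((E.horizon : ℝ) ^ 2 * Fintype.card A * δ) +
          ENNReal.ofReal ((E.horizon : ℝ) ^ 2 * Fintype.card A * δ) := by
        rw [Finset.sum_add_distrib]
        exact add_le_add (sum_disagreement_truth_le (hδ M hM))
          (sum_disagreement_truth_le (hδ M' hM'))
    _ = ENNReal.ofReal (2 * (E.horizon : ℝ) ^ 2 * Fintype.card A * δ) := by
        rw [← two_mul, ← ENNReal.ofReal_ofNat 2, ← ENNReal.ofReal_mul zero_le_two]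
        ring_nf

end Simulation

/-- Here `37 = 1 + 6²` is the gain in determinant at the relative distance `γ = 6`, and one factor
of `2` in `4` absorbs the halting round, as `T + 1 ≤ 2 T`. -/
theorem four_mul_log_five_thirds_le : 4 * Real.log (5 / 3) ≤ Real.log 37 - 1 := by
  have hexp : Real.exp 1 * (5 / 3) ^ 4 ≤ 37 := by linarith [Real.exp_one_lt_d9]
  have hlog := Real.log_le_log (by positivity) hexp
  rw [Real.log_mul (by positivity) (by positivity), Real.log_exp, Real.log_pow] at hlog
  push_cast at hlog
  linarith

namespace Trace

variable {S A : Type*} [MeasurableSpace S] [MeasurableSpace A]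

theorem modelSet_antitone (E : Env S A) {I : Inputs S A} (R : Trace I) :
    Antitone (R.modelSet E) :=
  antitone_nat_of_succ_le fun _ _ hM => hM.1

variable [Fintype A] [Nonempty A] {E : Env S A} {I : Inputs S A} {R : Trace I}

theorem Reaches.mono {r t : ℕ} (h : R.Reaches E t) (hrt : r ≤ t) : R.Reaches E r :=
  fun _ hq => h _ (hq.trans_le hrt)

theorem misfit_le_of_mem_modelSet (hacc : R.Accurate E) {r t : ℕ} (ht : R.Reaches E t)
    (hrt : r < t) {M : Model S A} (hM : M ∈ R.modelSet E t) {h : ℕ}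
    (hh : h ∈ Finset.Icc 1 E.horizon) : misfit E (R.policy r) M h ≤ 2 * I.φ := by
  have hest : |R.empMisfit r M h - misfit E (R.policy r) M h| ≤ I.φ :=
    hacc r (ht.mono hrt.le) (ht r hrt) h hh M (R.modelSet_antitone E t.zero_le hM)
  have hkept : R.empMisfit r M h ≤ I.φ := (R.modelSet_antitone E hrt hM).2 h hh
  linarith [(abs_le.1 hest).1]

theorem Explores.exists_lt_misfit (hε : 0 ≤ I.ε) {t : ℕ} (ht : R.Explores E t) :
    ∃ M ∈ R.modelSet E t, ∃ h ∈ Finset.Icc 1 E.horizon,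
      I.ε / (2 * (E.horizon : ℝ) ^ 2 * (Fintype.card A : ℝ) ^ 2) < misfit E (R.policy t) M h := by
  by_contra! hsmall
  refine ht.not_ge ((vExplore_le hsmall).trans (ENNReal.ofReal_le_ofReal ?_))
  rcases E.horizon.eq_zero_or_pos with hH | hH
  · have hpos : 0 ≤ I.ε / Fintype.card A := by positivity
    simpa [hH] using hpos
  · exact le_of_eq (by field_simp)

theorem card_mul_le_mul_log (hpol : ∀ t, R.Reaches E t → R.policy t ∈ I.policies)
    (hacc : R.Accurate E) (hφ : 0 < I.φ) {β γ : ℝ} {k h T : ℕ}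
    (hh : h ∈ Finset.Icc 1 E.horizon)
    (hfac : HasFactorization (misfitMatrix E I.policies I.models h) β k) (hγ : 1 ≤ γ)
    (hT : R.Reaches E T) {M : Fin T → Model S A} (hM : ∀ t : Fin T, M t ∈ R.modelSet E t)
    {s : Finset (Fin T)} (hs : s.Nonempty)
    (hlarge : ∀ t ∈ s, γ * √k * (2 * I.φ) < misfit E (R.policy t) (M t) h) :
    s.card * (Real.log (1 + γ ^ 2) - 1) ≤ 2 * k * Real.log (β / (2 * I.φ)) := by
  have hreach (t : Fin T) : R.Reaches E t := hT.mono t.is_lt.le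
  refine hfac.card_mul_le_mul_log (by positivity) hγ
    (row := fun t : Fin T => ⟨R.policy t, hpol t (hreach t)⟩)
    (col := fun t : Fin T => ⟨M t, R.modelSet_antitone E t.val.zero_le (hM t)⟩) hs
    (fun i _ j _ hij => ?_) fun i hi => ?_
  · exact (abs_of_nonneg (misfit_nonneg ..)).trans_le
      (misfit_le_of_mem_modelSet hacc (hreach j) hij (hM j) hh)
  · exact (hlarge i hi).trans_le (le_abs_self _)

theorem mul_le_mul_log (hpol : ∀ t, R.Reaches E t → R.policy t ∈ I.policies)
    (hacc : R.Accurate E) (hφ : 0 < I.φ) {β : ℝ} {d T : ℕ}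
    (hrank : ∀ h ∈ Finset.Icc 1 E.horizon,
      ∃ k ≤ d, HasFactorization (misfitMatrix E I.policies I.models h) β k)
    (hT0 : 0 < T) (hT : R.Reaches E T)
    (hlarge : ∀ t < T, ∃ M ∈ R.modelSet E t, ∃ h ∈ Finset.Icc 1 E.horizon,
      12 * √d * I.φ < misfit E (R.policy t) M h) :
    T * (Real.log 37 - 1) ≤ 2 * E.horizon * d * Real.log (β / (2 * I.φ)) := by
  choose M hM h hh hlarge using fun t : Fin T => hlarge t t.is_lt
  obtain ⟨h₀, hh₀, hmax⟩ := (Finset.Icc 1 E.horizon).exists_max_image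
    (fun y => (Finset.univ.filter fun t => h t = y).card) ⟨_, hh ⟨0, hT0⟩⟩
  set s := Finset.univ.filter fun t => h t = h₀
  have hTs : T ≤ s.card * E.horizon := by
    simpa using Finset.card_le_mul_card_image_of_maps_to (fun t _ => hh t) _ hmax
  have hs : 0 < s.card := Nat.pos_of_mul_pos_right (hT0.trans_le hTs)
  obtain ⟨k, hkd, hfac⟩ := hrank h₀ hh₀
  have hcount : s.card * (Real.log 37 - 1) ≤ 2 * k * Real.log (β / (2 * I.φ)) := by
    rw [show (37 : ℝ) = 1 + 6 ^ 2 by norm_num]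
    refine card_mul_le_mul_log hpol hacc hφ hh₀ hfac (by norm_num) hT hM (Finset.card_pos.1 hs)
      fun t ht => ?_
    obtain rfl : h t = h₀ := (Finset.mem_filter.1 ht).2
    calc 6 * √k * (2 * I.φ) = 12 * √k * I.φ := by ring
      _ ≤ 12 * √d * I.φ := by gcongr
      _ < misfit E (R.policy t) (M t) (h t) := hlarge t
  have hgain : 0 < Real.log 37 - 1 :=
    (mul_pos four_pos (Real.log_pos (by norm_num))).trans_le four_mul_log_five_thirds_le
  have hlog : 0 < Real.log (β / (2 * I.φ)) :=
    pos_of_mul_pos_right (lt_of_lt_of_le (by positivity) hcount) (by positivity)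
  calc T * (Real.log 37 - 1) ≤ (s.card * E.horizon : ℕ) * (Real.log 37 - 1) := by gcongr
    _ = E.horizon * (s.card * (Real.log 37 - 1)) := by push_cast; ring
    _ ≤ E.horizon * (2 * k * Real.log (β / (2 * I.φ))) := by gcongr
    _ ≤ E.horizon * (2 * d * Real.log (β / (2 * I.φ))) := by gcongr
    _ = 2 * E.horizon * d * Real.log (β / (2 * I.φ)) := by ring

theorem add_one_le_of_reaches (hε : 0 < I.ε)
    (hpol : ∀ t, R.Reaches E t → R.policy t ∈ I.policies) (hacc : R.Accurate E) {β : ℝ} {d T : ℕ}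
    (hrank : ∀ h ∈ Finset.Icc 1 E.horizon,
      ∃ k ≤ d, HasFactorization (misfitMatrix E I.policies I.models h) β k)
    (hφ : I.φ = I.ε / (24 * (E.horizon : ℝ) ^ 2 * (Fintype.card A : ℝ) ^ 2 * √d))
    (hT0 : 0 < T) (hT : R.Reaches E T) :
    (T : ℝ) + 1 ≤ E.horizon * d * Real.log (β / (2 * I.φ)) / Real.log (5 / 3) := by
  have hlarge (t : ℕ) (ht : t < T) := (hT t ht).exists_lt_misfit hε.le
  obtain ⟨M, hM, h, hh, hmisfit⟩ := hlarge 0 hT0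
  have hH : 0 < E.horizon := by
    obtain ⟨h1, hH⟩ := Finset.mem_Icc.1 hh
    omega
  obtain ⟨k, hkd, hfac⟩ := hrank h hh
  have hd : 0 < d := by
    refine (hfac.pos (i := ⟨R.policy 0, hpol 0 (hT.mono hT0.le)⟩) (j := ⟨M, hM⟩) ?_).trans_le hkd
    exact (lt_of_le_of_lt (by positivity) hmisfit).ne'
  have hφ0 : 0 < I.φ := by rw [hφ]; positivity
  have hthreshold : I.ε / (2 * (E.horizon : ℝ) ^ 2 * (Fintype.card A : ℝ) ^ 2) = 12 * √d * I.φ := by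
    rw [hφ]; field_simp; norm_num
  rw [hthreshold] at hlarge
  have hcount := mul_le_mul_log hpol hacc hφ0 hrank hT0 hT hlarge
  rw [le_div_iff₀ (Real.log_pos (by norm_num))]
  have hT1 : (1 : ℝ) ≤ T := by exact_mod_cast hT0
  calc (T + 1) * Real.log (5 / 3) ≤ (2 * T) * Real.log (5 / 3) :=
        mul_le_mul_of_nonneg_right (by linarith) (Real.log_nonneg (by norm_num))
    _ = T * (4 * Real.log (5 / 3)) / 2 := by ring
    _ ≤ T * (Real.log 37 - 1) / 2 := by gcongr; exact four_mul_log_five_thirds_le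
    _ ≤ E.horizon * d * Real.log (β / (2 * I.φ)) := by linarith

theorem exists_haltsWithRounds_le {C : ℝ}
    (hC : ∀ T, 0 < T → R.Reaches E T → (T : ℝ) + 1 ≤ C) :
    ∃ N, R.HaltsWithRounds E N ∧ (N : ℝ) ≤ max 1 C := by
  classical
  have hhalt : ∃ t, ¬ R.Explores E t := by
    by_contra! hforever
    obtain ⟨m, hm⟩ := exists_nat_gt C
    have hle := hC (m + 1) m.succ_pos fun r _ => hforever r
    push_cast at hle
    linarith
  have hreach : R.Reaches E (Nat.find hhalt) := fun r hr => not_not.1 (Nat.find_min hhalt hr)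
  refine ⟨Nat.find hhalt + 1, ⟨_, rfl, hreach, Nat.find_spec hhalt⟩, ?_⟩
  rcases (Nat.find hhalt).eq_zero_or_pos with h0 | hpos
  · simp [h0]
  · push_cast
    exact (hC _ hpos hreach).trans (le_max_right _ _)

end Trace

end DREEM

theorem lemma3_general {S A : Type*} [MeasurableSpace S] [MeasurableSpace A] [Fintype A]
    [Nonempty A] (E : DREEM.Env S A) (I : DREEM.Inputs S A) (R : DREEM.Trace I) (hε : 0 < I.ε)
    (β : ℝ) (d : ℕ)
    (hrank : ∀ h ∈ Finset.Icc 1 E.horizon,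
      ∃ k ≤ d, DREEM.HasFactorization (DREEM.misfitMatrix E I.policies I.models h) β k)
    (hφ : I.φ = I.ε / (24 * (E.horizon : ℝ) ^ 2 * (Fintype.card A : ℝ) ^ 2 * √(d : ℝ)))
    (hpol : ∀ t, R.Reaches E t → R.policy t ∈ I.policies)
    (hacc : R.Accurate E) :
    ∃ N : ℕ, R.HaltsWithRounds E N ∧
      (N : ℝ) ≤ max 1
        ((E.horizon : ℝ) * d * Real.log (β / (2 * I.φ)) / Real.log (5 / 3)) :=
  DREEM.Trace.exists_haltsWithRounds_le fun _ hT0 hT =>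
    DREEM.Trace.add_one_le_of_reaches hε hpol hacc hrank hφ hT0 hT

theorem lemma3 {S A : Type*} [MeasurableSpace S]
    [MeasurableSpace A] [MeasurableSingletonClass A] [Fintype A] [Nonempty A]
    (E : DREEM.Env S A) (I : DREEM.Inputs S A) (R : DREEM.Trace I)
    (htruth : E.truth ∈ I.models)
    (hε : 0 < I.ε)
    -- `β` is such that `rank(A_h, β)` is defined for every `h`, and `d` is the largest of them
    (β : ℝ) (d : ℕ)
    (hβ : ∀ h ∈ Finset.Icc 1 E.horizon,
      ∃ k, DREEM.HasFactorization (DREEM.misfitMatrix E I.policies I.models h) β k)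
    (hd : d = (Finset.Icc 1 E.horizon).sup fun h =>
      DREEM.boundedRank (DREEM.misfitMatrix E I.policies I.models h) β)
    (hφ : I.φ = I.ε / (24 * (E.horizon : ℝ) ^ 2 * (Fintype.card A : ℝ) ^ 2 * √(d : ℝ)))
    (hrun : R.IsExecution E)
    (hacc : R.Accurate E) :
    ∃ N : ℕ, R.HaltsWithRounds E N ∧
      (N : ℝ) ≤ max 1
        ((E.horizon : ℝ) * d * Real.log (β / (2 * I.φ)) / Real.log (5 / 3)) :=
  lemma3_general E I R hε β d
    (fun h hh => ⟨_, hd ▸ Finset.le_sup (f := fun h =>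
      DREEM.boundedRank (DREEM.misfitMatrix E I.policies I.models h) β) hh,
      DREEM.hasFactorization_boundedRank (hβ h hh)⟩)
    hφ (fun t ht => (hrun t ht).1) hacc
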